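/- **The model.** Let $C,S$ be finite sets of customer and server classes, $E\subset C\times S$ a bipartite graph, $S(U)=\{s:\exists c\in U,(c,s)\in E\}$ and $C(V)=\{c:\exists s\in V,(c,s)\in E\}$. A state is a pair $(x,y)\in\mathbb N^C\times\mathbb N^S$ of unmatched customers and servers with $\sum_c x_c=\sum_s y_s$ and $x_cy_s=0$ for all $(c,s)\in E$. At each time step a pair $(c,s)$ of law $\mu$ arrives, independently of the past. If the buffer contains customers of a class in $C(\{s\})$, the server $s$ departs with one of them, of a class chosen by the matching policy; likewise, if the buffer contains servers of a class in $S(\{c\})$, the customer $c$ departs with one of them, of a class chosen by the policy. If neither arrival can be matched with the buffer and $(c,s)\in E$, then $c$ and $s$ depart together. Arrivals that do not depart are added to the buffer. Under MS (Match the Shortest) the class is chosen uniformly among the available matchable classes with the smallest positive number of items in the buffer (independently for $c$ and for $s$ when both are matched with the buffer). Under the PR (priority) policy with matrices $A,B$ an arriving $c$ is matched with the available class $s'\in S(\{c\})$ with the largest $A_{cs'}$, and an arriving $s$ with the available class $c'\in C(\{s\})$ with the largest $B_{c's}$. The model is *stable* if the resulting Markov chain has a unique stationary probability measure $\pi$ and,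 for every initial law $\nu$, the Cesàro averages of $\nu P^n$ converge weakly to $\pi$ ($P$ is the transition matrix). The *stability region* of a policy is the set of all probability measures $\mu$ on $C\times S$ whose marginals $\mu_C,\mu_S$ have full support and for which the model is stable. NCond is the set of conditions $$\mu_C(U)<\mu_S(S(U))\ \ (\emptyset\ne U\subsetneq C),\qquad \mu_S(V)<\mu_C(C(V))\ \ (\emptyset\ne V\subsetneq S).$$ **Proposition.** Let $C=\{1,2,3\}$, $S=\{1',2',3'\}$ and $E=\{(1,2'),(1,3'),(2,1'),(2,2'),(3,1')\}$ (the NN graph). Consider either the MS policy or the PR policy with $$A=B=\begin{pmatrix}0&2&1\\2&1&0\\1&0&0\end{pmatrix}.$$ For each of these two policies the stability region is a proper subset of the set of probability measures $\mu$ on $C\times S$ whose marginals satisfy NCond. Explicitly, $\mu=\mu_C\times\mu_S$ with $\mu_C=\mu_S=(1/3,2/5,4/15)$ satisfies NCond, but the model is not stable under MS, and not stable under PR. -/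

import Mathlib

noncomputable section

namespace BipartiteMatching

section Model

variable {C S : Type*} [Fintype C] [Fintype S] [DecidableEq C] [DecidableEq S]

/-- `S(U)`: the server classes that can be matched with a customer class of `U`. -/
def serversOf (E : Finset (C × S)) (U : Finset C) : Finset S :=
  Finset.univ.filter fun s => ∃ c ∈ U, (c, s) ∈ E

/-- `C(V)`: the customer classes that can be matched with a server class of `V`. -/
def customersOf (E : Finset (C × S)) (V : Finset S) : Finset C :=
  Finset.univ.filter fun c => ∃ s ∈ V, (c, s) ∈ E

/-- The commutative state space of the matching graph `(C, S, E)`: `x c` unmatched customers of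
class `c` and `y s` unmatched servers of class `s`, equally many customers as servers in total,
and no possible match left in the buffer. -/
@[ext]
structure State (E : Finset (C × S)) where
  x : C → ℕ
  y : S → ℕ
  balanced : ∑ c, x c = ∑ s, y s
  unmatched : ∀ c s, (c, s) ∈ E → x c * y s = 0

/-- The classes of the customers in the buffer `x` that can be matched with an `s`-server. -/
def waitingC (E : Finset (C × S)) (x : C → ℕ) (s : S) : Finset C :=
  Finset.univ.filter fun c => (c, s) ∈ E ∧ 0 < x c

/-- The classes of the servers in the buffer `y` that can be matched with a `c`-customer. -/
def waitingS (E : Finset (C × S)) (y : S → ℕ) (c : C) : Finset S :=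
  Finset.univ.filter fun s => (c, s) ∈ E ∧ 0 < y s

/-- A (possibly randomized) admissible policy on the commutative state space: `Φ x s` is the law
of the class of the buffered customer with which an arriving `s`-server is matched, and `Ψ y c`
the law of the class of the buffered server with which an arriving `c`-customer is matched; they
are needed only when a match is available. -/
structure AdmissiblePolicy (E : Finset (C × S)) where
  Φ : ∀ (x : C → ℕ) (s : S), (waitingC E x s).Nonempty → PMF {c // c ∈ waitingC E x s}
  Ψ : ∀ (y : S → ℕ) (c : C), (waitingS E y c).Nonempty → PMF {s // s ∈ waitingS E y c}

theorem sum_add_single {ι : Type*} [Fintype ι] [DecidableEq ι] (f : ι → ℕ) (i : ι) :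
    ∑ j, (f + Pi.single i 1 : ι → ℕ) j = ∑ j, f j + 1 := by
  simp [Finset.sum_add_distrib]

theorem sub_single_add {ι : Type*} [DecidableEq ι] (f : ι → ℕ) (i : ι) (h : 0 < f i) :
    f - Pi.single i 1 + Pi.single i 1 = f := by
  funext j
  by_cases hj : j = i
  · subst hj; simp; omega
  · simp [hj]

theorem sum_sub_single {ι : Type*} [Fintype ι] [DecidableEq ι] (f : ι → ℕ) (i : ι)
    (h : 0 < f i) : ∑ j, (f - Pi.single i 1 : ι → ℕ) j + 1 = ∑ j, f j := by
  rw [← sum_add_single, sub_single_add f i h]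

theorem sub_single_eq_zero {ι : Type*} [DecidableEq ι] {f : ι → ℕ} (i : ι) {j : ι}
    (h : f j = 0) : (f - Pi.single i 1 : ι → ℕ) j = 0 := by
  simp [h]

namespace State

variable {E : Finset (C × S)}

/-- `(x + e_c, y + e_s)`: both arrivals are stored. -/
def store (z : State E) (c : C) (s : S) (hC : ¬ (waitingC E z.x s).Nonempty)
    (hS : ¬ (waitingS E z.y c).Nonempty) (hE : (c, s) ∉ E) : State E where
  x := z.x + Pi.single c 1
  y := z.y + Pi.single s 1
  balanced := by rw [sum_add_single, sum_add_single, z.balanced]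
  unmatched := by
    intro c' s' h
    have h1 := z.unmatched c' s' h
    have h2 : (c', s) ∈ E → z.x c' = 0 := fun h' => by
      by_contra h0
      exact hC ⟨c', by simp [waitingC, h', Nat.pos_of_ne_zero h0]⟩
    have h3 : (c, s') ∈ E → z.y s' = 0 := fun h' => by
      by_contra h0
      exact hS ⟨s', by simp [waitingS, h', Nat.pos_of_ne_zero h0]⟩
    by_cases hc : c' = c
    · subst hc
      have : s' ≠ s := by rintro rfl; exact hE h
      simp [this, h3 h]
    · by_cases hs : s' = s
      · subst hs
        simp [hc, h2 h]
      · simpa [hc, hs] using h1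

/-- `(x - e_c', y - e_s')`: both arrivals are matched with the buffer. -/
def matchBoth (z : State E) {c : C} {s : S} (c' : {c // c ∈ waitingC E z.x s})
    (s' : {s // s ∈ waitingS E z.y c}) : State E where
  x := z.x - Pi.single c'.1 1
  y := z.y - Pi.single s'.1 1
  balanced := by
    have hc : 0 < z.x c'.1 := (Finset.mem_filter.1 c'.2).2.2
    have hs : 0 < z.y s'.1 := (Finset.mem_filter.1 s'.2).2.2
    have h1 := sum_sub_single z.x c'.1 hc
    have h2 := sum_sub_single z.y s'.1 hs
    have h3 := z.balanced
    omega
  unmatched := by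
    intro a b h
    rcases Nat.mul_eq_zero.1 (z.unmatched a b h) with h0 | h0
    · rw [sub_single_eq_zero c'.1 h0, zero_mul]
    · rw [sub_single_eq_zero s'.1 h0, mul_zero]

/-- `(x - e_c' + e_c, y)`: the arriving server is matched, the arriving customer is stored. -/
def matchServer (z : State E) (c : C) {s : S} (c' : {c // c ∈ waitingC E z.x s})
    (hS : ¬ (waitingS E z.y c).Nonempty) : State E where
  x := z.x - Pi.single c'.1 1 + Pi.single c 1
  y := z.y
  balanced := by
    have hc : 0 < z.x c'.1 := (Finset.mem_filter.1 c'.2).2.2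
    rw [sum_add_single, sum_sub_single z.x c'.1 hc, z.balanced]
  unmatched := by
    intro a b h
    rcases Nat.mul_eq_zero.1 (z.unmatched a b h) with h0 | h0
    · by_cases ha : a = c
      · subst ha
        have : z.y b = 0 := by
          by_contra h1
          exact hS ⟨b, by simp [waitingS, h, Nat.pos_of_ne_zero h1]⟩
        rw [this, mul_zero]
      · simp [ha, h0]
    · rw [h0, mul_zero]

/-- `(x, y - e_s' + e_s)`: the arriving customer is matched, the arriving server is stored. -/
def matchCustomer (z : State E) {c : C} (s : S) (s' : {s // s ∈ waitingS E z.y c})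
    (hC : ¬ (waitingC E z.x s).Nonempty) : State E where
  x := z.x
  y := z.y - Pi.single s'.1 1 + Pi.single s 1
  balanced := by
    have hs : 0 < z.y s'.1 := (Finset.mem_filter.1 s'.2).2.2
    rw [sum_add_single, sum_sub_single z.y s'.1 hs, z.balanced]
  unmatched := by
    intro a b h
    rcases Nat.mul_eq_zero.1 (z.unmatched a b h) with h0 | h0
    · rw [h0, zero_mul]
    · by_cases hb : b = s
      · subst hb
        have : z.x a = 0 := by
          by_contra h1
          exact hC ⟨a, by simp [waitingC, h, Nat.pos_of_ne_zero h1]⟩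
        rw [this, zero_mul]
      · simp [hb, h0]

end State

/-- The law of the next state when the pair `a = (c, s)` arrives in the state `z`. When both
arrivals can be matched with the buffer, the two choices are made independently. -/
def step {E : Finset (C × S)} (pol : AdmissiblePolicy E) (z : State E) (a : C × S) :
    PMF (State E) :=
  if hC : (waitingC E z.x a.2).Nonempty then
    if hS : (waitingS E z.y a.1).Nonempty then
      (pol.Φ z.x a.2 hC).bind fun c' => (pol.Ψ z.y a.1 hS).map fun s' => z.matchBoth c' s'
    else
      (pol.Φ z.x a.2 hC).map fun c' => z.matchServer a.1 c' hS
  else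
    if hS : (waitingS E z.y a.1).Nonempty then
      (pol.Ψ z.y a.1 hS).map fun s' => z.matchCustomer a.2 s' hC
    else
      if hE : a ∈ E then PMF.pure z else PMF.pure (z.store a.1 a.2 hC hS hE)

/-- The transition kernel of the buffer content for i.i.d. arrivals of law `μ`. -/
def chain {E : Finset (C × S)} (pol : AdmissiblePolicy E) (μ : PMF (C × S)) (z : State E) :
    PMF (State E) :=
  μ.bind fun a => step pol z a

end Model

section MarkovChain

variable {X : Type*}

/-- The law `ν Pⁿ` at time `n` of the Markov chain with kernel `P` and initial law `ν`. -/
def lawAt (P : X → PMF X) (ν : PMF X) : ℕ → PMF X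
  | 0 => ν
  | n + 1 => (lawAt P ν n).bind P

/-- `π P = π`. -/
def IsStationary (P : X → PMF X) (π : PMF X) : Prop :=
  π.bind P = π

/-- The integral of a bounded function `f` against a discrete probability measure. -/
def expect (π : PMF X) (f : X → ℝ) : ℝ :=
  ∑' z, (π z).toReal * f z

/-- For every initial law `ν` the Cesàro averages of `ν Pⁿ` converge weakly to `π`. The state
space is discrete, so that every bounded function is a test function. -/
def IsAttractive (P : X → PMF X) (π : PMF X) : Prop :=
  ∀ (ν : PMF X) (f : X → ℝ), (∃ M : ℝ, ∀ z, |f z| ≤ M) →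
    Filter.Tendsto
      (fun n : ℕ => (n : ℝ)⁻¹ * ∑ k ∈ Finset.range n, expect (lawAt P ν k) f)
      Filter.atTop (nhds (expect π f))

/-- There is a unique stationary probability measure, and it is attractive. -/
def IsStable (P : X → PMF X) : Prop :=
  ∃ π : PMF X, IsStationary P π ∧ IsAttractive P π ∧ ∀ π' : PMF X, IsStationary P π' → π' = π

end MarkovChain

section Region

variable {C S : Type*} [Fintype C] [Fintype S] [DecidableEq C] [DecidableEq S]

/-- The conditions NCond on a pair of probability measures on `C` and on `S`. -/
def NCond (E : Finset (C × S)) (μC : PMF C) (μS : PMF S) : Prop :=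
  (∀ U : Finset C, U.Nonempty → U ≠ Finset.univ →
    ∑ c ∈ U, μC c < ∑ s ∈ serversOf E U, μS s) ∧
  (∀ V : Finset S, V.Nonempty → V ≠ Finset.univ →
    ∑ s ∈ V, μS s < ∑ c ∈ customersOf E V, μC c)

/-- The arrival laws whose marginals satisfy NCond. -/
def ncondRegion (E : Finset (C × S)) : Set (PMF (C × S)) :=
  {μ | NCond E (μ.map Prod.fst) (μ.map Prod.snd)}

/-- The arrival laws `μ`, with marginals of full support, for which the model is stable. -/
def stabilityRegion {E : Finset (C × S)} (pol : AdmissiblePolicy E) : Set (PMF (C × S)) :=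
  {μ | (μ.map Prod.fst).support = Set.univ ∧ (μ.map Prod.snd).support = Set.univ ∧
    IsStable (chain pol μ)}

end Region

section Policies

variable {C S : Type*} [Fintype C] [Fintype S] [DecidableEq C] [DecidableEq S]

/-- The points of a finite set `W` at which the function `f` is largest on `W`. -/
def argmax {ι : Type*} (W : Finset ι) (f : ι → ℤ) : Finset {i // i ∈ W} :=
  Finset.univ.filter fun i => ∀ j ∈ W, f j ≤ f i

theorem argmax_nonempty {ι : Type*} (W : Finset ι) (f : ι → ℤ) (h : W.Nonempty) :
    (argmax W f).Nonempty := by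
  obtain ⟨i, hi, hmax⟩ := W.exists_max_image f h
  exact ⟨⟨i, hi⟩, by simpa [argmax] using hmax⟩

/-- MS (Match the Shortest): the match is uniformly distributed on the available classes with the
least (positive) number of buffered items. -/
def matchShortest (E : Finset (C × S)) : AdmissiblePolicy E where
  Φ x s h := PMF.uniformOfFinset (argmax (waitingC E x s) fun c => -(x c : ℤ))
    (argmax_nonempty _ _ h)
  Ψ y c h := PMF.uniformOfFinset (argmax (waitingS E y c) fun s => -(y s : ℤ))
    (argmax_nonempty _ _ h)

/-- PR (Priorities): an arriving `c`-customer is matched with the available server class `s` with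
the greatest priority `A c s`, an arriving `s`-server with the available customer class `c` with
the greatest priority `B c s`. The match is deterministic when, as for the matrix `nnPriority`
below, the priorities of the possible matches of each class are distinct. -/
def priority (E : Finset (C × S)) (A B : Matrix C S ℕ) : AdmissiblePolicy E where
  Φ x s h := PMF.uniformOfFinset (argmax (waitingC E x s) fun c => (B c s : ℤ))
    (argmax_nonempty _ _ h)
  Ψ y c h := PMF.uniformOfFinset (argmax (waitingS E y c) fun s => (A c s : ℤ))
    (argmax_nonempty _ _ h)

end Policies

/-- The NN graph: the customer classes `1, 2, 3` and the server classes `1', 2', 3'` are both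
indexed by `0, 1, 2`; the edges are `(1,2'), (1,3'), (2,1'), (2,2'), (3,1')`. -/
def nnGraph : Finset (Fin 3 × Fin 3) :=
  {(0, 1), (0, 2), (1, 0), (1, 1), (2, 0)}

/-- The common value of the two priority matrices `A` and `B`. -/
def nnPriority : Matrix (Fin 3) (Fin 3) ℕ :=
  !![0, 2, 1;
     2, 1, 0;
     1, 0, 0]

/-- The probability measure `(1/3, 2/5, 4/15)` on three classes. -/
def nnMarginal : PMF (Fin 3) :=
  PMF.ofFintype (fun i => ENNReal.ofReal ((![1 / 3, 2 / 5, 4 / 15] : Fin 3 → ℝ) i)) (by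
    rw [← ENNReal.ofReal_sum_of_nonneg]
    · simp [Fin.sum_univ_three]; norm_num
    · intro i _; fin_cases i <;> simp <;> norm_num)

/-- The product `μ_C × μ_S` of two discrete probability measures. -/
def prodPMF {C S : Type*} (μC : PMF C) (μS : PMF S) : PMF (C × S) :=
  μC.bind fun c => μS.map fun s => (c, s)

end BipartiteMatching

end

open BipartiteMatching

/-!
Suppose first that NCond fails, say for a set `U` of customer classes (the case of a set of server
classes reduces to it by complementation). The number of customers of `U` minus the number of
servers of `S(U)` in the buffer never drops by more than one, is not decreased by departures, and
is at least as likely to be raised as to be lowered by an arriving pair. Balancing the flows between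
the levels `k` and `k + 1` shows that under a stationary law its distribution is a nondecreasing
probability mass function on `ℤ` (or that it never decreases at all, if no pair raises it), which is
impossible.

On the NN graph, both policies match the class 2 rather than the class 3 when the class 2 is the
shorter of the two. As long as only items of the classes 2 and 3 wait and the class 3 is the longer
one on both sides, the numbers of waiting items of the two classes therefore follow an explicit
random walk. When no item of the class 2 waits, the class 3 loses on average; but enough items of
the class 2 are typically waiting for the class 3 to grow on the whole. A superharmonic function
that decays geometrically along this escape then excludes an attractive law, because its mean under
such a law would be at most its infimum, which is `0`.
-/

namespace BipartiteMatching

open scoped ENNReal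
open Filter

section Mean

variable {X Y : Type*}

/-- The integral of a `[0, ∞]`-valued function against a discrete probability measure: unlike
`expect`, it needs no summability. -/
noncomputable def mean (p : PMF X) (h : X → ℝ≥0∞) : ℝ≥0∞ :=
  ∑' x, p x * h x

theorem mean_bind (p : PMF X) (f : X → PMF Y) (h : Y → ℝ≥0∞) :
    mean (p.bind f) h = mean p fun x => mean (f x) h := by
  simp only [mean, PMF.bind_apply, ← ENNReal.tsum_mul_right, ← ENNReal.tsum_mul_left]
  rw [ENNReal.tsum_comm]
  simp only [mul_assoc]

theorem mean_pure (x : X) (h : X → ℝ≥0∞) : mean (PMF.pure x) h = h x := by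
  rw [mean, tsum_eq_single x fun y hy => by rw [PMF.pure_apply_of_ne _ _ hy, zero_mul],
    PMF.pure_apply_self, one_mul]

theorem mean_map (p : PMF X) (f : X → Y) (h : Y → ℝ≥0∞) :
    mean (p.map f) h = mean p fun x => h (f x) := by
  simp only [PMF.map, mean_bind, Function.comp_apply, mean_pure]

theorem mean_const (p : PMF X) (b : ℝ≥0∞) : mean p (fun _ => b) = b := by
  rw [mean, ENNReal.tsum_mul_right, p.tsum_coe, one_mul]

theorem mean_add (p : PMF X) (f g : X → ℝ≥0∞) :
    mean p (fun x => f x + g x) = mean p f + mean p g := by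
  simp only [mean, mul_add, ENNReal.tsum_add]

theorem mean_const_mul (p : PMF X) (b : ℝ≥0∞) (f : X → ℝ≥0∞) :
    mean p (fun x => b * f x) = b * mean p f := by
  simp only [mean, ← ENNReal.tsum_mul_left, mul_left_comm]

theorem mean_mul_const (p : PMF X) (f : X → ℝ≥0∞) (b : ℝ≥0∞) :
    mean p (fun x => f x * b) = mean p f * b := by
  simp only [mul_comm _ b, mean_const_mul]

theorem mean_mono {p : PMF X} {f g : X → ℝ≥0∞} (h : ∀ x ∈ p.support, f x ≤ g x) :
    mean p f ≤ mean p g := by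
  refine ENNReal.tsum_le_tsum fun x => ?_
  by_cases hx : p x = 0
  · simp only [hx, zero_mul, le_refl]
  · exact mul_le_mul_right (h x hx) _

theorem mean_le_of_le {p : PMF X} {f : X → ℝ≥0∞} {b : ℝ≥0∞} (h : ∀ x ∈ p.support, f x ≤ b) :
    mean p f ≤ b :=
  (mean_mono h).trans_eq (mean_const p b)

theorem mean_eq_zero_iff {p : PMF X} {h : X → ℝ≥0∞} :
    mean p h = 0 ↔ ∀ x ∈ p.support, h x = 0 := by
  simp only [mean, ENNReal.tsum_eq_zero, mul_eq_zero, PMF.mem_support_iff, or_iff_not_imp_left]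

theorem mean_ite_eq (p : PMF X) (f : X → Y) (y : Y) [DecidablePred fun x => f x = y] :
    mean p (fun x => if f x = y then 1 else 0) = p.map f y := by
  classical
  rw [PMF.map_apply, mean]
  refine tsum_congr fun x => ?_
  simp only [mul_ite, mul_one, mul_zero, eq_comm]

theorem mean_ite_mem (p : PMF X) (f : X → Y) (U : Finset Y) [DecidableEq Y] :
    mean p (fun x => if f x ∈ U then 1 else 0) = ∑ y ∈ U, p.map f y := by
  rw [← mean_map p f fun y => if y ∈ U then 1 else 0, mean,
    tsum_eq_sum (s := U) fun y hy => by rw [if_neg hy, mul_zero]]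
  exact Finset.sum_congr rfl fun y hy => by rw [if_pos hy, mul_one]

theorem mean_ite_and_not_le {p : PMF X} {F G : X → Prop} [DecidablePred F] [DecidablePred G]
    (h : mean p (fun x => if G x then 1 else 0) ≤ mean p (fun x => if F x then 1 else 0)) :
    mean p (fun x => if G x ∧ ¬ F x then 1 else 0) ≤
      mean p (fun x => if F x ∧ ¬ G x then 1 else 0) := by
  have hboth : mean p (fun x => if F x ∧ G x then 1 else 0) ≠ ∞ :=
    ne_top_of_le_ne_top ENNReal.one_ne_top (mean_le_of_le fun x _ => by split_ifs <;> simp)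
  refine (ENNReal.add_le_add_iff_right hboth).1 ?_
  rw [← mean_add, ← mean_add]
  refine le_of_eq_of_le (congrArg (mean p) (funext fun x => ?_))
    (h.trans_eq (congrArg (mean p) (funext fun x => ?_))) <;>
  by_cases hF : F x <;> by_cases hG : G x <;> simp [hF, hG]

theorem expect_toReal {p : PMF X} {h : X → ℝ≥0∞} (hh : ∀ x, h x ≠ ∞) :
    expect p (fun x => (h x).toReal) = (mean p h).toReal := by
  rw [mean, ENNReal.tsum_toReal_eq fun x => ENNReal.mul_ne_top (p.apply_ne_top x) (hh x)]
  simp only [expect, ENNReal.toReal_mul]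

theorem mean_ofReal [Finite X] (p : PMF X) {f : X → ℝ} (hf : ∀ x, 0 ≤ f x) :
    mean p (fun x => ENNReal.ofReal (f x)) = ENNReal.ofReal (expect p f) := by
  have hfin : mean p (fun x => ENNReal.ofReal (f x)) ≠ ∞ := by
    have := Fintype.ofFinite X
    rw [mean, tsum_fintype]
    exact ENNReal.sum_ne_top.2 fun x _ =>
      ENNReal.mul_ne_top (p.apply_ne_top x) ENNReal.ofReal_ne_top
  rw [← ENNReal.ofReal_toReal hfin, ← expect_toReal fun _ => ENNReal.ofReal_ne_top]
  simp only [ENNReal.toReal_ofReal (hf _)]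

theorem mean_prodPMF (p : PMF X) (q : PMF Y) (h : X × Y → ℝ≥0∞) :
    mean (prodPMF p q) h = mean p fun x => mean q fun y => h (x, y) := by
  simp only [prodPMF, mean_bind, mean_map]

end Mean

section Instability

variable {X : Type*} {P : X → PMF X}

theorem mean_lawAt_le {h : X → ℝ≥0∞} (hP : ∀ z, mean (P z) h ≤ h z) (ν : PMF X) (n : ℕ) :
    mean (lawAt P ν n) h ≤ mean ν h := by
  induction n with
  | zero => exact le_rfl
  | succ n ih =>
    rw [lawAt, mean_bind]
    exact (mean_mono fun z _ => hP z).trans ih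

theorem IsAttractive.mean_le {π : PMF X} (hπ : IsAttractive P π) {h : X → ℝ≥0∞}
    (h_le : ∀ z, h z ≤ 1) (hP : ∀ z, mean (P z) h ≤ h z) (ν : PMF X) : mean π h ≤ mean ν h := by
  have h_ne_top z : h z ≠ ∞ := ne_top_of_le_ne_top ENNReal.one_ne_top (h_le z)
  have mean_ne_top (p : PMF X) : mean p h ≠ ∞ :=
    ne_top_of_le_ne_top ENNReal.one_ne_top (mean_le_of_le fun z _ => h_le z)
  have h_bdd z : |(h z).toReal| ≤ 1 := by
    rw [abs_of_nonneg ENNReal.toReal_nonneg]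
    exact ENNReal.toReal_mono ENNReal.one_ne_top (h_le z)
  have hlim := hπ ν (fun z => (h z).toReal) ⟨1, h_bdd⟩
  simp only [expect_toReal h_ne_top] at hlim
  rw [← ENNReal.toReal_le_toReal (mean_ne_top π) (mean_ne_top ν)]
  refine le_of_tendsto hlim ((eventually_gt_atTop 0).mono fun n hn => ?_)
  rw [inv_mul_le_iff₀ (Nat.cast_pos.2 hn)]
  calc ∑ k ∈ Finset.range n, (mean (lawAt P ν k) h).toReal
      ≤ ∑ _k ∈ Finset.range n, (mean ν h).toReal :=
        Finset.sum_le_sum fun k _ => ENNReal.toReal_mono (mean_ne_top ν) (mean_lawAt_le hP ν k)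
    _ = n * (mean ν h).toReal := by rw [Finset.sum_const, Finset.card_range, nsmul_eq_mul]

theorem not_isStable_of_superharmonic {h : X → ℝ≥0∞} (h_pos : ∀ z, 0 < h z)
    (h_inf : ⨅ z, h z = 0) (hP : ∀ z, h z < 1 → mean (P z) h ≤ h z) : ¬ IsStable P := by
  -- Only the truncation `min h 1` is superharmonic on the whole state space.
  rintro ⟨π, -, hπ, -⟩
  have trunc_superharmonic z : mean (P z) (fun z => min (h z) 1) ≤ min (h z) 1 := by
    refine le_min ?_ (mean_le_of_le fun z' _ => min_le_right _ _)
    rcases lt_or_ge (h z) 1 with hz | hz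
    · exact (mean_mono fun z' _ => min_le_left _ _).trans (hP z hz)
    · exact (mean_le_of_le fun z' _ => min_le_right _ _).trans hz
  have mean_trunc : mean π (fun z => min (h z) 1) = 0 := by
    rw [← nonpos_iff_eq_zero, ← h_inf]
    refine le_iInf fun z => (hπ.mean_le (fun _ => min_le_right _ _) trunc_superharmonic
      (PMF.pure z)).trans ?_
    rw [mean_pure]
    exact min_le_left _ _
  obtain ⟨z, hz⟩ := π.support_nonempty
  exact (lt_min (h_pos z) one_pos).ne' (mean_eq_zero_iff.1 mean_trunc z hz)

theorem not_isStable_of_nondecreasing {α : Type*} [Preorder α] {d : X → α}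
    (hd : ∀ z, ∀ z' ∈ (P z).support, d z ≤ d z') (d_unbdd : ¬ BddAbove (Set.range d)) :
    ¬ IsStable P := by
  classical
  rintro ⟨π, -, hπ, -⟩
  obtain ⟨x, hx⟩ := π.support_nonempty
  obtain ⟨_, ⟨z, rfl⟩, hz⟩ := not_bddAbove_iff'.1 d_unbdd (d x)
  have hmean := hπ.mean_le (h := fun z => if d z ≤ d x then 1 else 0)
    (fun z => by split_ifs <;> simp) (fun z => mean_le_of_le fun z' hz' => ?_) (PMF.pure z)
  · rw [mean_pure, if_neg hz, nonpos_iff_eq_zero, mean_eq_zero_iff] at hmean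
    simpa using hmean x hx
  · by_cases hle : d z' ≤ d x
    · rw [if_pos hle, if_pos ((hd z z' hz').trans hle)]
    · rw [if_neg hle]
      exact zero_le

end Instability

section Drift

variable {X A : Type*} {μ : PMF A} {st : X → A → PMF X} {d : X → ℤ} {ξ : A → ℤ}

theorem not_monotone_pmf_int (q : PMF ℤ) : ¬ Monotone q := by
  intro hq
  obtain ⟨k, hk⟩ := q.support_nonempty
  refine ENNReal.one_ne_top (top_le_iff.1 ?_)
  calc ∞ = ∑' _n : ℕ, q k := (ENNReal.tsum_const_eq_top_of_ne_zero hk).symm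
    _ ≤ ∑' n : ℕ, q (k + n) := ENNReal.tsum_le_tsum fun n => hq (by omega)
    _ ≤ ∑' j, q j := ENNReal.tsum_comp_le_tsum_of_injective
        (fun (m n : ℕ) (h : k + (m : ℤ) = k + n) => by omega) q
    _ = 1 := q.tsum_coe

/-- By stationarity, the mass of the levels above `k` is the same before and after a step. -/
theorem IsStationary.flow_up_le_flow_down {π : PMF X}
    (hπ : IsStationary (fun z => μ.bind (st z)) π) (hξ : ∀ a, -1 ≤ ξ a)
    (hst : ∀ z a, ∀ z' ∈ (st z a).support, d z + ξ a ≤ d z') (k : ℤ) :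
    π.map d k * μ.map ξ 1 ≤ π.map d (k + 1) * μ.map ξ (-1) := by
  let above : X → ℝ≥0∞ := fun z => if k < d z then 1 else 0
  have above_ne_top : mean π above ≠ ∞ := ne_top_of_le_ne_top ENNReal.one_ne_top
    (mean_le_of_le fun z _ => by simp only [above]; split_ifs <;> simp)
  have crossing z a z' (hz' : z' ∈ (st z a).support) :
      above z + (if d z = k then 1 else 0) * (if ξ a = 1 then 1 else 0) ≤
        above z' + (if d z = k + 1 then 1 else 0) * (if ξ a = -1 then 1 else 0) := by
    have := hst z a z' hz'
    have := hξ a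
    simp only [above]
    split_ifs <;> first | omega | simp
  refine (ENNReal.add_le_add_iff_left above_ne_top).1 ?_
  calc mean π above + π.map d k * μ.map ξ 1
      = mean π fun z => mean μ fun a =>
          above z + (if d z = k then 1 else 0) * (if ξ a = 1 then 1 else 0) := by
        simp only [mean_add, mean_const, mean_const_mul, mean_mul_const, mean_ite_eq]
    _ ≤ mean π fun z => mean μ fun a => mean (st z a) fun z' =>
          above z' + (if d z = k + 1 then 1 else 0) * (if ξ a = -1 then 1 else 0) :=
        mean_mono fun z _ => mean_mono fun a _ =>
          (mean_const (st z a) _).symm.trans_le (mean_mono (crossing z a))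
    _ = mean (π.bind fun z => μ.bind (st z)) above + π.map d (k + 1) * μ.map ξ (-1) := by
        simp only [mean_add, mean_const, mean_const_mul, mean_mul_const, mean_ite_eq, mean_bind]
    _ = mean π above + π.map d (k + 1) * μ.map ξ (-1) := by rw [hπ]

theorem not_isStable_of_drift (hξ : ∀ a, -1 ≤ ξ a)
    (hst : ∀ z a, ∀ z' ∈ (st z a).support, d z + ξ a ≤ d z') (d_unbdd : ¬ BddAbove (Set.range d))
    (hdrift : μ.map ξ (-1) ≤ μ.map ξ 1) : ¬ IsStable fun z => μ.bind (st z) := by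
  by_cases h_up : μ.map ξ 1 = 0
  · have h_down : -1 ∉ (μ.map ξ).support :=
      (PMF.apply_eq_zero_iff _ _).1 (nonpos_iff_eq_zero.1 (hdrift.trans_eq h_up))
    refine not_isStable_of_nondecreasing (fun z z' hz' => ?_) d_unbdd
    obtain ⟨a, ha, hz'⟩ := (PMF.mem_support_bind_iff _ _ _).1 hz'
    have hne : ξ a ≠ -1 := fun h => h_down ((PMF.mem_support_map_iff _ _ _).2 ⟨a, ha, h⟩)
    have := hst z a z' hz'
    have := hξ a
    omega
  · rintro ⟨π, hπ, -, -⟩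
    refine not_monotone_pmf_int (π.map d) (monotone_int_of_le_succ fun k => ?_)
    refine (ENNReal.mul_le_mul_iff_left h_up (PMF.apply_ne_top _ _)).1 ?_
    exact (hπ.flow_up_le_flow_down hξ hst k).trans (mul_le_mul_right hdrift _)

end Drift

section Necessity

variable {C S : Type*} [DecidableEq C] [DecidableEq S] {E : Finset (C × S)}

theorem mem_waitingC [Fintype C] {x : C → ℕ} {c : C} {s : S} :
    c ∈ waitingC E x s ↔ (c, s) ∈ E ∧ 0 < x c := by
  simp only [waitingC, Finset.mem_filter, Finset.mem_univ, true_and]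

theorem mem_waitingS [Fintype S] {y : S → ℕ} {c : C} {s : S} :
    s ∈ waitingS E y c ↔ (c, s) ∈ E ∧ 0 < y s := by
  simp only [waitingS, Finset.mem_filter, Finset.mem_univ, true_and]

theorem sum_cast_add_single {ι : Type*} [DecidableEq ι] (U : Finset ι) (f : ι → ℕ) (i : ι) :
    ∑ j ∈ U, ((f + Pi.single i 1 : ι → ℕ) j : ℤ) = ∑ j ∈ U, (f j : ℤ) + if i ∈ U then 1 else 0 := by
  simp [Finset.sum_add_distrib, Pi.single_apply]

theorem sum_cast_sub_single {ι : Type*} [DecidableEq ι] (U : Finset ι) {f : ι → ℕ} {i : ι}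
    (hi : 0 < f i) :
    ∑ j ∈ U, ((f - Pi.single i 1 : ι → ℕ) j : ℤ) = ∑ j ∈ U, (f j : ℤ) - if i ∈ U then 1 else 0 := by
  rw [eq_sub_iff_add_eq, ← sum_cast_add_single, sub_single_add f i hi]

theorem ite_mem_le_of_serversOf_subset [Fintype S] {U : Finset C} {T : Finset S}
    (hUT : serversOf E U ⊆ T) {c : C} {s : S} (hcs : (c, s) ∈ E) :
    (if c ∈ U then (1 : ℤ) else 0) ≤ if s ∈ T then 1 else 0 := by
  by_cases hc : c ∈ U
  · have hs : s ∈ T := hUT (Finset.mem_filter.2 ⟨Finset.mem_univ _, c, hc, hcs⟩)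
    rw [if_pos hc, if_pos hs]
  · rw [if_neg hc]
    split_ifs <;> decide

variable [Fintype C] [Fintype S] {pol : AdmissiblePolicy E} {z z' : State E}

/-- The transitions out of `z` that have positive probability when the pair `(c, s)` arrives, one
constructor for each branch of `step`. -/
inductive Transition (pol : AdmissiblePolicy E) (z : State E) (c : C) (s : S) : State E → Prop
  | matchBoth (hC : (waitingC E z.x s).Nonempty) (hS : (waitingS E z.y c).Nonempty)
      (c' : {c // c ∈ waitingC E z.x s}) (hc' : c' ∈ (pol.Φ z.x s hC).support)
      (s' : {s // s ∈ waitingS E z.y c}) (hs' : s' ∈ (pol.Ψ z.y c hS).support) :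
      Transition pol z c s (z.matchBoth c' s')
  | matchServer (hC : (waitingC E z.x s).Nonempty) (hS : ¬ (waitingS E z.y c).Nonempty)
      (c' : {c // c ∈ waitingC E z.x s}) (hc' : c' ∈ (pol.Φ z.x s hC).support) :
      Transition pol z c s (z.matchServer c c' hS)
  | matchCustomer (hC : ¬ (waitingC E z.x s).Nonempty) (hS : (waitingS E z.y c).Nonempty)
      (s' : {s // s ∈ waitingS E z.y c}) (hs' : s' ∈ (pol.Ψ z.y c hS).support) :
      Transition pol z c s (z.matchCustomer s s' hC)
  | departTogether (hC : ¬ (waitingC E z.x s).Nonempty) (hS : ¬ (waitingS E z.y c).Nonempty)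
      (hE : (c, s) ∈ E) : Transition pol z c s z
  | store (hC : ¬ (waitingC E z.x s).Nonempty) (hS : ¬ (waitingS E z.y c).Nonempty)
      (hE : (c, s) ∉ E) : Transition pol z c s (z.store c s hC hS hE)

theorem transition_of_mem_support_step {c : C} {s : S} (h : z' ∈ (step pol z (c, s)).support) :
    Transition pol z c s z' := by
  unfold step at h
  split_ifs at h with hC hS hS hE
  · obtain ⟨c', hc', h⟩ := (PMF.mem_support_bind_iff _ _ _).1 h
    obtain ⟨s', hs', rfl⟩ := (PMF.mem_support_map_iff _ _ _).1 h
    exact .matchBoth hC hS c' hc' s' hs'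
  · obtain ⟨c', hc', rfl⟩ := (PMF.mem_support_map_iff _ _ _).1 h
    exact .matchServer hC hS c' hc'
  · obtain ⟨s', hs', rfl⟩ := (PMF.mem_support_map_iff _ _ _).1 h
    exact .matchCustomer hC hS s' hs'
  · obtain rfl := (PMF.mem_support_pure_iff _ _).1 h
    exact .departTogether hC hS hE
  · obtain rfl := (PMF.mem_support_pure_iff _ _).1 h
    exact .store hC hS hE

/-- The number of buffered customers of the classes `U` minus the number of buffered servers of
the classes `T`: the quantity that drifts upwards when NCond fails. -/
def imbalance (U : Finset C) (T : Finset S) (z : State E) : ℤ :=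
  ∑ c ∈ U, (z.x c : ℤ) - ∑ s ∈ T, (z.y s : ℤ)

/-- The departures can only increase the imbalance: a customer of `U` leaves with a server of
`T`. -/
theorem imbalance_add_le {U : Finset C} {T : Finset S} (hUT : serversOf E U ⊆ T) {a : C × S}
    (h : z' ∈ (step pol z a).support) :
    imbalance U T z + ((if a.1 ∈ U then 1 else 0) - if a.2 ∈ T then 1 else 0) ≤
      imbalance U T z' := by
  obtain ⟨c, s⟩ := a
  have depart {c s} (hcs : (c, s) ∈ E) := ite_mem_le_of_serversOf_subset hUT hcs
  cases transition_of_mem_support_step h with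
  | matchBoth _ _ c' _ s' _ =>
    obtain ⟨hc's, hc'⟩ := mem_waitingC.1 c'.2
    obtain ⟨hcs', hs'⟩ := mem_waitingS.1 s'.2
    simp only [imbalance, State.matchBoth, sum_cast_sub_single _ hc', sum_cast_sub_single _ hs']
    linarith [depart hc's, depart hcs']
  | matchServer _ _ c' _ =>
    obtain ⟨hc's, hc'⟩ := mem_waitingC.1 c'.2
    simp only [imbalance, State.matchServer, sum_cast_add_single, sum_cast_sub_single _ hc']
    linarith [depart hc's]
  | matchCustomer _ _ s' _ =>
    obtain ⟨hcs', hs'⟩ := mem_waitingS.1 s'.2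
    simp only [imbalance, State.matchCustomer, sum_cast_add_single, sum_cast_sub_single _ hs']
    linarith [depart hcs']
  | departTogether _ _ hE => linarith [depart hE]
  | store _ _ _ =>
    simp only [imbalance, State.store, sum_cast_add_single]
    linarith

/-- The state with `n` customers of class `c` and `n` servers of class `s`. -/
def singleState {c : C} {s : S} (hcs : (c, s) ∉ E) (n : ℕ) : State E where
  x := Pi.single c n
  y := Pi.single s n
  balanced := by simp only [Finset.sum_pi_single', Finset.mem_univ, if_true]
  unmatched c' s' h := by
    by_cases hc : c' = c
    · have hs : s' ≠ s := fun hs => hcs (hc ▸ hs ▸ h)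
      rw [Pi.single_eq_of_ne hs, mul_zero]
    · rw [Pi.single_eq_of_ne hc, zero_mul]

theorem not_bddAbove_range_imbalance {U : Finset C} {T : Finset S} (hUT : serversOf E U ⊆ T)
    (hU : U.Nonempty) (hT : T ≠ Finset.univ) :
    ¬ BddAbove (Set.range (imbalance U T : State E → ℤ)) := by
  obtain ⟨c, hc⟩ := hU
  obtain ⟨s, hs⟩ : ∃ s, s ∉ T := by simpa [Finset.eq_univ_iff_forall] using hT
  have hcs : (c, s) ∉ E := fun h => hs (hUT (Finset.mem_filter.2 ⟨Finset.mem_univ _, c, hc, h⟩))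
  refine not_bddAbove_iff.2 fun k => ⟨_, ⟨singleState hcs (k.toNat + 1), rfl⟩, ?_⟩
  have hx : ∑ i ∈ U, ((Pi.single c (k.toNat + 1) : C → ℕ) i : ℤ) = k.toNat + 1 := by
    rw [← Nat.cast_sum, Finset.sum_pi_single', if_pos hc, Nat.cast_succ]
  have hy : ∑ i ∈ T, ((Pi.single s (k.toNat + 1) : S → ℕ) i : ℤ) = 0 := by
    rw [← Nat.cast_sum, Finset.sum_pi_single', if_neg hs, Nat.cast_zero]
  simp only [imbalance, singleState, hx, hy]
  omega

theorem not_isStable_of_serversOf_subset (pol : AdmissiblePolicy E) {μ : PMF (C × S)}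
    {U : Finset C} {T : Finset S} (hUT : serversOf E U ⊆ T) (hU : U.Nonempty)
    (hT : T ≠ Finset.univ) (hμ : ∑ s ∈ T, μ.map Prod.snd s ≤ ∑ c ∈ U, μ.map Prod.fst c) :
    ¬ IsStable (chain pol μ) := by
  let ξ : C × S → ℤ := fun a => (if a.1 ∈ U then 1 else 0) - if a.2 ∈ T then 1 else 0
  have ξ_eq_one a : ξ a = 1 ↔ a.1 ∈ U ∧ a.2 ∉ T := by
    by_cases h₁ : a.1 ∈ U <;> by_cases h₂ : a.2 ∈ T <;> simp [ξ, h₁, h₂]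
  have ξ_eq_neg_one a : ξ a = -1 ↔ a.2 ∈ T ∧ a.1 ∉ U := by
    by_cases h₁ : a.1 ∈ U <;> by_cases h₂ : a.2 ∈ T <;> simp [ξ, h₁, h₂]
  have neg_one_le_ξ a : -1 ≤ ξ a := by
    simp only [ξ]
    split_ifs <;> decide
  refine not_isStable_of_drift neg_one_le_ξ (fun z a z' => imbalance_add_le hUT)
    (not_bddAbove_range_imbalance hUT hU hT) ?_
  rw [← mean_ite_eq, ← mean_ite_eq]
  simp only [ξ_eq_one, ξ_eq_neg_one]
  rw [← mean_ite_mem, ← mean_ite_mem] at hμ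
  exact mean_ite_and_not_le hμ

theorem eq_univ_of_one_le_sum {B : Type*} [Fintype B] {ν : PMF B} (hν : ν.support = Set.univ)
    {U : Finset B} (hU : 1 ≤ ∑ b ∈ U, ν b) : U = Finset.univ := by
  have sum_eq_one : ν.toOuterMeasure U = 1 := by
    rw [PMF.toOuterMeasure_apply_finset]
    exact hU.antisymm' (ν.tsum_coe ▸ ENNReal.sum_le_tsum U)
  rw [PMF.toOuterMeasure_apply_eq_one_iff, hν, Set.univ_subset_iff] at sum_eq_one
  exact Finset.coe_eq_univ.1 sum_eq_one

theorem sum_univ_eq_one {B : Type*} [Fintype B] (ν : PMF B) : ∑ b, ν b = 1 := by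
  rw [← ν.tsum_coe, tsum_fintype]

theorem sum_compl_le_sum_compl {B B' : Type*} [Fintype B] [Fintype B'] [DecidableEq B]
    [DecidableEq B'] {ν : PMF B} {ν' : PMF B'} {U : Finset B} {V : Finset B'}
    (h : ∑ b ∈ U, ν b ≤ ∑ b ∈ V, ν' b) : ∑ b ∈ Vᶜ, ν' b ≤ ∑ b ∈ Uᶜ, ν b := by
  have sum_ne_top : ∑ b ∈ V, ν' b ≠ ∞ := ENNReal.sum_ne_top.2 fun b _ => ν'.apply_ne_top b
  refine (ENNReal.add_le_add_iff_right sum_ne_top).1 ?_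
  rw [Finset.sum_compl_add_sum, sum_univ_eq_one, ← sum_univ_eq_one ν, ← Finset.sum_compl_add_sum U]
  exact add_le_add_right h _

theorem serversOf_compl_customersOf_subset (V : Finset S) :
    serversOf E (customersOf E V)ᶜ ⊆ Vᶜ := by
  intro s hs
  obtain ⟨-, c, hc, hcs⟩ := Finset.mem_filter.1 hs
  rw [Finset.mem_compl] at hc ⊢
  exact fun hsV => hc (Finset.mem_filter.2 ⟨Finset.mem_univ _, s, hsV, hcs⟩)

theorem stabilityRegion_subset_ncondRegion (pol : AdmissiblePolicy E) :
    stabilityRegion pol ⊆ ncondRegion E := by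
  rintro μ ⟨hC, hS, hstable⟩
  refine ⟨fun U hU hU_univ => ?_, fun V hV hV_univ => ?_⟩
  · by_contra! hle
    refine not_isStable_of_serversOf_subset pol subset_rfl hU (fun h => hU_univ ?_) hle hstable
    rw [h, sum_univ_eq_one] at hle
    exact eq_univ_of_one_le_sum hC hle
  · by_contra! hle
    refine not_isStable_of_serversOf_subset pol (serversOf_compl_customersOf_subset V)
      (Finset.nonempty_iff_ne_empty.2 fun h => hV_univ ?_)
      (fun h => hV.ne_empty ((Finset.compl_eq_univ_iff V).1 h)) (sum_compl_le_sum_compl hle)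
      hstable
    rw [Finset.compl_eq_empty_iff] at h
    rw [h, sum_univ_eq_one] at hle
    exact eq_univ_of_one_le_sum hS hle

end Necessity

section Marginal

variable {C S : Type*}

theorem prodPMF_map_fst (p : PMF C) (q : PMF S) : (prodPMF p q).map Prod.fst = p := by
  have fst_mk (c : C) : (fun s : S => (Prod.mk c s).1) = Function.const S c := rfl
  simp only [prodPMF, PMF.map_bind, PMF.map_comp, Function.comp_def, fst_mk, PMF.map_const,
    PMF.bind_pure]

theorem prodPMF_map_snd (p : PMF C) (q : PMF S) : (prodPMF p q).map Prod.snd = q := by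
  simp only [prodPMF, PMF.map_bind, PMF.map_comp, Function.comp_def, PMF.bind_const]
  exact q.map_id

/-- The numerators of `(1/3, 2/5, 4/15)` over the common denominator `15`, which make NCond
decidable. -/
def nnWeight : Fin 3 → ℕ :=
  ![5, 6, 4]

theorem nnMarginal_apply (i : Fin 3) : nnMarginal i = nnWeight i / 15 := by
  change ENNReal.ofReal ((![1 / 3, 2 / 5, 4 / 15] : Fin 3 → ℝ) i) = _
  rw [← ENNReal.ofReal_natCast, ← ENNReal.ofReal_ofNat, ← ENNReal.ofReal_div_of_pos (by norm_num)]
  congr 1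
  fin_cases i <;> norm_num [nnWeight]

theorem sum_nnMarginal (U : Finset (Fin 3)) :
    ∑ i ∈ U, nnMarginal i = (∑ i ∈ U, nnWeight i : ℕ) / 15 := by
  simp only [nnMarginal_apply, ENNReal.div_eq_inv_mul, ← Finset.mul_sum, Nat.cast_sum]

theorem sum_nnMarginal_lt_iff {U V : Finset (Fin 3)} :
    ∑ i ∈ U, nnMarginal i < ∑ i ∈ V, nnMarginal i ↔
      ∑ i ∈ U, nnWeight i < ∑ i ∈ V, nnWeight i := by
  rw [sum_nnMarginal, sum_nnMarginal,
    ENNReal.div_lt_div_iff_left (by norm_num) (ENNReal.ofNat_ne_top), Nat.cast_lt]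

theorem prodPMF_nnMarginal_mem_ncondRegion :
    prodPMF nnMarginal nnMarginal ∈ ncondRegion nnGraph := by
  change NCond _ _ _
  rw [prodPMF_map_fst, prodPMF_map_snd]
  simp only [NCond, sum_nnMarginal_lt_iff]
  decide

theorem expect_nnMarginal (f : Fin 3 → ℝ) :
    expect nnMarginal f = 1 / 3 * f 0 + 2 / 5 * f 1 + 4 / 15 * f 2 := by
  simp only [expect, tsum_fintype, Fin.sum_univ_three, nnMarginal_apply, nnWeight,
    ENNReal.toReal_div, ENNReal.toReal_natCast, ENNReal.toReal_ofNat, Matrix.cons_val]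
  norm_num

end Marginal

section Preference

/-- The policy matches the second class rather than the third one whenever the second class is
available and the less numerous. -/
def PrefersSecond (pol : AdmissiblePolicy nnGraph) : Prop :=
  (∀ x s h, ∀ c ∈ (pol.Φ x s h).support, x 0 = 0 → 0 < x 1 → x 1 < x 2 → c.1 = 1) ∧
  (∀ y c h, ∀ s ∈ (pol.Ψ y c h).support, y 0 = 0 → 0 < y 1 → y 1 < y 2 → s.1 = 1)

theorem mem_nnGraph_comm {i j : Fin 3} : (i, j) ∈ nnGraph ↔ (j, i) ∈ nnGraph := by
  decide +revert

theorem le_of_mem_support_uniformOfFinset_argmax {ι : Type*} {W : Finset ι} {f : ι → ℤ}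
    (h : W.Nonempty) {i : {i // i ∈ W}}
    (hi : i ∈ (PMF.uniformOfFinset (argmax W f) (argmax_nonempty W f h)).support) :
    ∀ j ∈ W, f j ≤ f i :=
  (Finset.mem_filter.1 ((PMF.mem_support_uniformOfFinset_iff _ i).1 hi)).2

theorem eq_one_of_forall_le {W : Finset (Fin 3)} {f : Fin 3 → ℤ} {x : Fin 3 → ℕ} {i j : Fin 3}
    (hW : ∀ k, k ∈ W ↔ (k, i) ∈ nnGraph ∧ 0 < x k) (hj : j ∈ W) (hmax : ∀ k ∈ W, f k ≤ f j)
    (hx0 : x 0 = 0) (hx1 : 0 < x 1) (hf : i = 0 → f 2 < f 1) : j = 1 := by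
  obtain ⟨hji, hxj⟩ := (hW j).1 hj
  have hj0 : j ≠ 0 := fun hj0 => hxj.ne' (hj0 ▸ hx0)
  have hj2 : j ≠ 2 := by
    rintro rfl
    have eq_zero_of_edge : ∀ i, (2, i) ∈ nnGraph → i = 0 := by decide
    obtain rfl := eq_zero_of_edge i hji
    exact (hf rfl).not_ge (hmax 1 ((hW 1).2 ⟨by decide, hx1⟩))
  omega

theorem prefersSecond_matchShortest : PrefersSecond (matchShortest nnGraph) :=
  ⟨fun _ _ h c hc h0 h1 h12 => eq_one_of_forall_le (fun _ => mem_waitingC) c.2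
      (le_of_mem_support_uniformOfFinset_argmax h hc) h0 h1 fun _ => by omega,
    fun _ _ h s hs h0 h1 h12 => eq_one_of_forall_le
      (fun _ => mem_waitingS.trans (and_congr_left' mem_nnGraph_comm)) s.2
      (le_of_mem_support_uniformOfFinset_argmax h hs) h0 h1 fun _ => by omega⟩

theorem prefersSecond_priority : PrefersSecond (priority nnGraph nnPriority nnPriority) :=
  ⟨fun _ _ h c hc h0 h1 _ => eq_one_of_forall_le (fun _ => mem_waitingC) c.2
      (le_of_mem_support_uniformOfFinset_argmax h hc) h0 h1 (by rintro rfl; decide),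
    fun _ _ h s hs h0 h1 _ => eq_one_of_forall_le
      (fun _ => mem_waitingS.trans (and_congr_left' mem_nnGraph_comm)) s.2
      (le_of_mem_support_uniformOfFinset_argmax h hs) h0 h1 (by rintro rfl; decide)⟩

end Preference

section Escape

variable {pol : AdmissiblePolicy nnGraph} {z z' : State nnGraph} {c s : Fin 3}

/-- Only items of the second and third classes wait, and on both sides the third class is the more
numerous: the region into which the chain escapes. -/
def IsThirdHeavy (z : State nnGraph) : Prop :=
  z.x 0 = 0 ∧ z.y 0 = 0 ∧ z.x 1 < z.x 2 ∧ z.y 1 < z.y 2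

/-- The number of buffered items of the second classes, counted positively for customers and
negatively for servers: since `(2, 2')` is an edge, only one of the two classes is waiting. -/
def second (z : State nnGraph) : ℤ :=
  z.x 1 - z.y 1

/-- The number of buffered items of the third classes. -/
def third (z : State nnGraph) : ℤ :=
  z.x 2 + z.y 2

/-- The change of `second` caused by an arriving customer when `second` equals `w`; for arriving
servers the sign of `w` and the sign of the change are reversed. -/
def secondIncr (w : ℤ) : Fin 3 → ℤ :=
  ![if w < 0 then 1 else 0, 1, 0]

/-- The change of `third` caused by an arriving customer when `second` equals `w`; for arriving
servers the sign of `w` is reversed. -/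
def thirdIncr (w : ℤ) : Fin 3 → ℤ :=
  ![if 0 ≤ w then -1 else 0, 0, 1]

theorem matched_class {f : Fin 3 → ℕ} {i j : Fin 3} (hf0 : f 0 = 0) (hji : (j, i) ∈ nnGraph)
    (hj : 0 < f j) (hsecond : 0 < f 1 → j = 1) :
    j = 1 ∧ (i = 0 ∨ i = 1) ∧ 0 < f 1 ∨ j = 2 ∧ i = 0 ∧ f 1 = 0 := by
  fin_cases j
  · exact absurd hf0 hj.ne'
  · exact .inl ⟨rfl, by revert hji; decide +revert, hj⟩
  · refine .inr ⟨rfl, by revert hji; decide +revert, ?_⟩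
    by_contra h
    exact absurd (hsecond (Nat.pos_of_ne_zero h)) (by decide)

theorem unmatched_class {f : Fin 3 → ℕ} {i : Fin 3} (hf2 : 0 < f 2)
    (h : ∀ j, (j, i) ∈ nnGraph → f j = 0) : i = 2 ∨ i = 1 ∧ f 1 = 0 := by
  fin_cases i
  · exact absurd (h 2 (by decide)) hf2.ne'
  · exact .inr ⟨rfl, h 1 (by decide)⟩
  · exact .inl rfl

theorem IsThirdHeavy.matched_customer (hz : IsThirdHeavy z) (hpol : PrefersSecond pol)
    {hC : (waitingC nnGraph z.x s).Nonempty} {c' : {c // c ∈ waitingC nnGraph z.x s}}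
    (hc' : c' ∈ (pol.Φ z.x s hC).support) :
    c'.1 = 1 ∧ (s = 0 ∨ s = 1) ∧ 0 < z.x 1 ∨ c'.1 = 2 ∧ s = 0 ∧ z.x 1 = 0 := by
  obtain ⟨hx0, -, hx12, -⟩ := hz
  obtain ⟨hc's, hpos⟩ := mem_waitingC.1 c'.2
  exact matched_class hx0 hc's hpos fun hx1 => hpol.1 _ _ _ c' hc' hx0 hx1 hx12

theorem IsThirdHeavy.matched_server (hz : IsThirdHeavy z) (hpol : PrefersSecond pol)
    {hS : (waitingS nnGraph z.y c).Nonempty} {s' : {s // s ∈ waitingS nnGraph z.y c}}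
    (hs' : s' ∈ (pol.Ψ z.y c hS).support) :
    s'.1 = 1 ∧ (c = 0 ∨ c = 1) ∧ 0 < z.y 1 ∨ s'.1 = 2 ∧ c = 0 ∧ z.y 1 = 0 := by
  obtain ⟨-, hy0, -, hy12⟩ := hz
  obtain ⟨hcs', hpos⟩ := mem_waitingS.1 s'.2
  exact matched_class hy0 (mem_nnGraph_comm.1 hcs') hpos
    fun hy1 => hpol.2 _ _ _ s' hs' hy0 hy1 hy12

theorem IsThirdHeavy.unmatched_server (hz : IsThirdHeavy z)
    (hC : ¬ (waitingC nnGraph z.x s).Nonempty) : s = 2 ∨ s = 1 ∧ z.x 1 = 0 := by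
  obtain ⟨-, -, hx12, -⟩ := hz
  refine unmatched_class (Nat.zero_lt_of_lt hx12) fun c hcs => ?_
  by_contra h0
  exact hC ⟨c, mem_waitingC.2 ⟨hcs, Nat.pos_of_ne_zero h0⟩⟩

theorem IsThirdHeavy.unmatched_customer (hz : IsThirdHeavy z)
    (hS : ¬ (waitingS nnGraph z.y c).Nonempty) : c = 2 ∨ c = 1 ∧ z.y 1 = 0 := by
  obtain ⟨-, -, -, hy12⟩ := hz
  refine unmatched_class (Nat.zero_lt_of_lt hy12) fun s hsc => ?_
  by_contra h0
  exact hS ⟨s, mem_waitingS.2 ⟨mem_nnGraph_comm.1 hsc, Nat.pos_of_ne_zero h0⟩⟩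

theorem second_classes_eq_zero (z : State nnGraph) : z.x 1 = 0 ∨ z.y 1 = 0 :=
  Nat.mul_eq_zero.1 (z.unmatched 1 1 (by decide))

theorem IsThirdHeavy.second_lt_third (hz : IsThirdHeavy z)
    (hfar : 3 * |second z| + 4 < third z) : z.x 1 + 2 < z.x 2 ∧ z.y 1 + 2 < z.y 2 := by
  obtain ⟨hx0, hy0, -, -⟩ := hz
  have hbalance := z.balanced
  have hzero := second_classes_eq_zero z
  have hle := le_abs_self (second z)
  have hneg_le := neg_le_abs (second z)
  simp only [Fin.sum_univ_three, hx0, hy0] at hbalance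
  simp only [second, third] at hfar hle hneg_le
  omega

theorem Transition.isThirdHeavy_and_incr (h : Transition pol z c s z') (hpol : PrefersSecond pol)
    (hz : IsThirdHeavy z) (hfar : 3 * |second z| + 4 < third z) :
    IsThirdHeavy z' ∧ third z' = third z + (thirdIncr (second z) c + thirdIncr (-second z) s) ∧
      second z' = second z + (secondIncr (second z) c - secondIncr (-second z) s) := by
  obtain ⟨hx12, hy12⟩ := hz.second_lt_third hfar
  have hzero := second_classes_eq_zero z
  have ⟨hx0, hy0, _, _⟩ := hz
  simp only [IsThirdHeavy, second, third, secondIncr, thirdIncr]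
  cases h with
  | matchBoth hC hS c' hc' s' hs' =>
    simp only [State.matchBoth, Pi.sub_apply, Pi.single_apply]
    obtain ⟨hc', rfl | rfl, hx1⟩ | ⟨hc', rfl, hx1⟩ := hz.matched_customer hpol hc' <;>
    obtain ⟨hs', rfl | rfl, hy1⟩ | ⟨hs', rfl, hy1⟩ := hz.matched_server hpol hs' <;>
    simp only [hc', hs', Fin.reduceEq, if_true, if_false, Matrix.cons_val] <;> omega
  | matchServer hC hS c' hc' =>
    simp only [State.matchServer, Pi.sub_apply, Pi.add_apply, Pi.single_apply]
    obtain ⟨hc', rfl | rfl, hx1⟩ | ⟨hc', rfl, hx1⟩ := hz.matched_customer hpol hc' <;>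
    obtain rfl | ⟨rfl, hy1⟩ := hz.unmatched_customer hS <;>
    simp only [hc', Fin.reduceEq, if_true, if_false, Matrix.cons_val] <;> omega
  | matchCustomer hC hS s' hs' =>
    simp only [State.matchCustomer, Pi.sub_apply, Pi.add_apply, Pi.single_apply]
    obtain ⟨hs', rfl | rfl, hy1⟩ | ⟨hs', rfl, hy1⟩ := hz.matched_server hpol hs' <;>
    obtain rfl | ⟨rfl, hx1⟩ := hz.unmatched_server hC <;>
    simp only [hs', Fin.reduceEq, if_true, if_false, Matrix.cons_val] <;> omega
  | departTogether hC hS hE =>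
    obtain rfl | ⟨rfl, hx1⟩ := hz.unmatched_server hC <;>
    obtain rfl | ⟨rfl, hy1⟩ := hz.unmatched_customer hS
    case inr.inr =>
      simp only [Matrix.cons_val]
      omega
    all_goals exact absurd hE (by decide)
  | store hC hS hE =>
    simp only [State.store, Pi.add_apply, Pi.single_apply]
    obtain rfl | ⟨rfl, hx1⟩ := hz.unmatched_server hC <;>
    obtain rfl | ⟨rfl, hy1⟩ := hz.unmatched_customer hS
    case inr.inr => exact absurd (by decide) hE
    all_goals
      simp only [Fin.reduceEq, if_true, if_false, Matrix.cons_val]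
      omega

end Escape

section Potential

/-- The value of the potential at a state with `m` items of the third and `k` items of the second
classes. The factor `(19/20) ^ m * (39/40) ^ k` is superharmonic far out in the region; the term
`2 ^ k`, with a coefficient small enough not to spoil this at `k = 0`, makes the value at least `1`
where the second classes are no longer outnumbered. -/
noncomputable def decay (m k : ℤ) : ℝ :=
  250 * ((19 / 20) ^ m * ((39 / 40) ^ k + 2 ^ k / 200))

theorem decay_pos (m k : ℤ) : 0 < decay m k := by
  unfold decay
  positivity

theorem decay_eq (m k : ℤ) :
    decay m k =
      250 * ((19 / 20) ^ m * (39 / 40) ^ k) + 250 * ((19 / 20) ^ m * 2 ^ k) / 200 := by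
  unfold decay
  ring

theorem decay_add (m k i j : ℤ) :
    decay (m + i) (k + j) = 250 * ((19 / 20) ^ m * (39 / 40) ^ k) * ((19 / 20) ^ i * (39 / 40) ^ j)
      + 250 * ((19 / 20) ^ m * 2 ^ k) * ((19 / 20) ^ i * 2 ^ j) / 200 := by
  rw [decay_eq, zpow_add₀ (by norm_num), zpow_add₀ (by norm_num), zpow_add₀ (by norm_num)]
  ring

theorem one_le_decay {m k : ℤ} (hk : 0 ≤ k) (hmk : m ≤ 3 * k + 4) : 1 ≤ decay m k := by
  lift k to ℕ using hk
  calc (1 : ℝ) ≤ 250 * ((19 / 20) ^ 4 * ((19 / 20) ^ 3 * 2) ^ k / 200) := by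
        have : (1 : ℝ) ≤ ((19 / 20) ^ 3 * 2) ^ k := one_le_pow₀ (by norm_num)
        linarith
    _ = 250 * ((19 / 20) ^ (3 * k + 4 : ℤ) * (2 ^ (k : ℤ) / 200)) := by
        rw [zpow_add₀ (by norm_num), zpow_mul, mul_pow]
        norm_cast
        ring
    _ ≤ 250 * ((19 / 20) ^ m * ((39 / 40) ^ (k : ℤ) + 2 ^ (k : ℤ) / 200)) := by
        have := zpow_le_zpow_right_of_le_one₀ (a := (19 / 20 : ℝ)) (by norm_num) (by norm_num) hmk
        have : (0 : ℝ) ≤ (39 / 40) ^ (k : ℤ) := by positivity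
        gcongr
        linarith

theorem tendsto_decay_zero : Tendsto (fun n : ℕ => decay (2 * n) 0) atTop (nhds 0) := by
  have hpow := (tendsto_pow_atTop_nhds_zero_of_lt_one (r := (19 / 20 : ℝ) ^ 2) (by norm_num)
    (by norm_num)).const_mul (250 * (1 + 1 / 200))
  rw [mul_zero] at hpow
  refine hpow.congr fun n => ?_
  rw [decay, zpow_mul, zpow_natCast, zpow_zero, zpow_zero]
  norm_cast
  ring

theorem expect_decay_le (m w : ℤ) :
    (expect nnMarginal fun c => expect nnMarginal fun s =>
      decay (m + (thirdIncr w c + thirdIncr (-w) s))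
        |w + (secondIncr w c - secondIncr (-w) s)|) ≤ decay m |w| := by
  simp only [expect_nnMarginal, secondIncr, thirdIncr, Matrix.cons_val, Left.neg_neg_iff,
    Left.nonneg_neg_iff]
  rcases eq_or_ne w 0 with rfl | hw
  · have hu : (0 : ℝ) < (19 / 20) ^ m := by positivity
    simp only [decay, zpow_add₀ (show (19 / 20 : ℝ) ≠ 0 by norm_num)]
    generalize (19 / 20 : ℝ) ^ m = u at hu ⊢
    norm_num
    linarith
  have hu : (0 : ℝ) < (19 / 20) ^ m * (39 / 40) ^ |w| := by positivity
  have hv : (0 : ℝ) < (19 / 20) ^ m * 2 ^ |w| := by positivity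
  rw [decay_eq m |w|]
  rcases hw.lt_or_gt with hw | hw
  · have habs (j : ℤ) (hj : j ≤ 1) : |w + j| = |w| + -j := by
      rw [abs_of_nonpos (by omega), abs_of_neg hw, neg_add]
    simp only [if_pos hw, if_pos hw.le, if_neg hw.not_ge, if_neg hw.not_gt]
    simp (discharger := decide) only [habs, decay_add]
    generalize (19 / 20 : ℝ) ^ m * (39 / 40) ^ |w| = u at hu ⊢
    generalize (19 / 20 : ℝ) ^ m * 2 ^ |w| = v at hv ⊢
    norm_num
    linarith
  · have habs (j : ℤ) (hj : -1 ≤ j) : |w + j| = |w| + j := by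
      rw [abs_of_nonneg (by omega), abs_of_pos hw]
    simp only [if_pos hw, if_pos hw.le, if_neg hw.not_ge, if_neg hw.not_gt]
    simp (discharger := decide) only [habs, decay_add]
    generalize (19 / 20 : ℝ) ^ m * (39 / 40) ^ |w| = u at hu ⊢
    generalize (19 / 20 : ℝ) ^ m * 2 ^ |w| = v at hv ⊢
    norm_num
    linarith

open Classical in
/-- The superharmonic function that witnesses the escape of the chain. -/
noncomputable def potential (z : State nnGraph) : ℝ≥0∞ :=
  if IsThirdHeavy z then ENNReal.ofReal (decay (third z) |second z|) else 1

theorem potential_of_isThirdHeavy {z : State nnGraph} (hz : IsThirdHeavy z) :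
    potential z = ENNReal.ofReal (decay (third z) |second z|) :=
  if_pos hz

theorem potential_pos (z : State nnGraph) : 0 < potential z := by
  unfold potential
  split_ifs
  · exact ENNReal.ofReal_pos.2 (decay_pos _ _)
  · exact one_pos

theorem iInf_potential_eq_zero : ⨅ z, potential z = 0 := by
  have third_third_notMem : ((2, 2) : Fin 3 × Fin 3) ∉ nnGraph := by decide
  have hlim := ENNReal.tendsto_ofReal tendsto_decay_zero
  rw [ENNReal.ofReal_zero] at hlim
  rw [← nonpos_iff_eq_zero]
  refine ge_of_tendsto hlim ((eventually_gt_atTop 0).mono fun n hn => ?_)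
  refine (iInf_le _ (singleState third_third_notMem n)).trans_eq ?_
  rw [potential_of_isThirdHeavy (by simpa [IsThirdHeavy, singleState] using hn)]
  simp [third, second, singleState, two_mul]

theorem mean_chain_potential_le {pol : AdmissiblePolicy nnGraph} (hpol : PrefersSecond pol)
    {z : State nnGraph} (hz : potential z < 1) :
    mean (chain pol (prodPMF nnMarginal nnMarginal) z) potential ≤ potential z := by
  have hthird : IsThirdHeavy z := by
    by_contra h
    exact hz.ne (if_neg h)
  rw [potential_of_isThirdHeavy hthird] at hz ⊢
  have hfar : 3 * |second z| + 4 < third z := by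
    by_contra! hle
    exact (ENNReal.ofReal_lt_one.1 hz).not_ge (one_le_decay (abs_nonneg _) hle)
  let next (c s : Fin 3) : ℝ :=
    decay (third z + (thirdIncr (second z) c + thirdIncr (-second z) s))
      |second z + (secondIncr (second z) c - secondIncr (-second z) s)|
  have next_nonneg c s : 0 ≤ next c s := (decay_pos _ _).le
  calc mean (chain pol (prodPMF nnMarginal nnMarginal) z) potential
      = mean nnMarginal fun c => mean nnMarginal fun s => mean (step pol z (c, s)) potential := by
        rw [chain, mean_bind, mean_prodPMF]
    _ ≤ mean nnMarginal fun c => mean nnMarginal fun s => ENNReal.ofReal (next c s) := by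
        refine mean_mono fun c _ => mean_mono fun s _ => mean_le_of_le fun z' hz' => ?_
        obtain ⟨hthird', h_third, h_second⟩ :=
          (transition_of_mem_support_step hz').isThirdHeavy_and_incr hpol hthird hfar
        rw [potential_of_isThirdHeavy hthird', h_third, h_second]
    _ = ENNReal.ofReal (expect nnMarginal fun c => expect nnMarginal (next c)) := by
        simp only [mean_ofReal nnMarginal (next_nonneg _)]
        exact mean_ofReal nnMarginal fun c =>
          tsum_nonneg fun s => mul_nonneg ENNReal.toReal_nonneg (next_nonneg c s)
    _ ≤ ENNReal.ofReal (decay (third z) |second z|) :=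
        ENNReal.ofReal_le_ofReal (expect_decay_le _ _)

theorem not_isStable_nnGraph {pol : AdmissiblePolicy nnGraph} (hpol : PrefersSecond pol) :
    ¬ IsStable (chain pol (prodPMF nnMarginal nnMarginal)) :=
  not_isStable_of_superharmonic potential_pos iInf_potential_eq_zero
    fun _ => mean_chain_potential_le hpol

end Potential

end BipartiteMatching

theorem mainTheorem2_general {pol : AdmissiblePolicy nnGraph} (hpol : PrefersSecond pol) :
    stabilityRegion pol ⊂ ncondRegion nnGraph ∧
    prodPMF nnMarginal nnMarginal ∈ ncondRegion nnGraph ∧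
    ¬ IsStable (chain pol (prodPMF nnMarginal nnMarginal)) := by
  have unstable := not_isStable_nnGraph hpol
  refine ⟨⟨stabilityRegion_subset_ncondRegion pol, fun hsubset => ?_⟩,
    prodPMF_nnMarginal_mem_ncondRegion, unstable⟩
  exact unstable (hsubset prodPMF_nnMarginal_mem_ncondRegion).2.2

theorem mainTheorem2 :
    (stabilityRegion (matchShortest nnGraph) ⊂ ncondRegion nnGraph ∧
      stabilityRegion (priority nnGraph nnPriority nnPriority) ⊂ ncondRegion nnGraph) ∧
    prodPMF nnMarginal nnMarginal ∈ ncondRegion nnGraph ∧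
    ¬ IsStable (chain (matchShortest nnGraph) (prodPMF nnMarginal nnMarginal)) ∧
    ¬ IsStable (chain (priority nnGraph nnPriority nnPriority)
        (prodPMF nnMarginal nnMarginal)) := by
  obtain ⟨shortest_ssubset, ncond, shortest_unstable⟩ :=
    mainTheorem2_general prefersSecond_matchShortest
  obtain ⟨priority_ssubset, -, priority_unstable⟩ := mainTheorem2_general prefersSecond_priority
  exact ⟨⟨shortest_ssubset, priority_ssubset⟩, ncond, shortest_unstable, priority_unstable⟩
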